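/- Let $(G_t)_{t\ge 0}$ be a family of non-decreasing functions $G_t:\mathbb R\to\mathbb R$ with $\lim_{x\to-\infty}G_t(x)=0$ for every $t\ge 0$. Suppose that there is an $\varepsilon>0$, independent of $t$, such that the Laplace--Stieltjes transforms $$\hat G_t(s)=\int_{-\infty}^{\infty}e^{-sx}\,\mathrm dG_t(x)$$ are finite for all $t\ge 0$ and $s\in(0,\varepsilon)$, and that the double transform $$\hat{\mathfrak G}(\lambda,s)=\int_0^\infty e^{-\lambda t}\,\hat G_t(s)\,\mathrm dt$$ is well defined (the integrand is integrable) for all $\lambda>0$ and $s\in(0,\varepsilon)$. Suppose that $t\mapsto\hat G_t(s)$ is non-decreasing on $[T,\infty)$ for every $s\in(0,\varepsilon)$, where $T\ge 0$ does not depend on $s$ (for instance $T=0$). Let $(s_\lambda)_{\lambda>0}$ be a family of positive numbers with $s_\lambda\to 0$ as $\lambda\to 0^+$, such that $s_\lambda=O(s_{k\lambda})$ as $\lambda\to 0^+$ for every integer $k\ge 1$ (for instance, $\lambda\mapsto s_\lambda$ non-decreasing near $0$). Let $\alpha>0$, $\gamma>1$, and let $\ell$ and $L$ be positive slowly varying functions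 at infinity. Suppose that $$\lim_{\lambda\to 0^+}\ \sup_{0<s\le\theta s_\lambda}\left|\frac{\hat{\mathfrak G}(\lambda,s)}{L(1/\lambda)\,\lambda^{-\gamma}\,s^{-\alpha}\,\ell(1/s)}-1\right|=0\qquad\text{for every }\theta>0 .$$ Then, with $x_t=1/s_{1/t}$, $$\lim_{t\to\infty}\ \sup_{x\ge x_t}\left|\Gamma(\gamma)\,\Gamma(\alpha+1)\,\frac{G_t(x)}{L(t)\,t^{\gamma-1}\,\ell(x)\,x^{\alpha}}-1\right|=0 .$$ -/

import Mathlib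

open Filter Topology MeasureTheory Set Real

noncomputable section

/-- Slowly varying at infinity, in the sense of Karamata: positive and measurable on some
half-line `[X, ∞)`, with `f (c x) / f x → 1` as `x → ∞` for every `c > 0`. -/
def IsSlowlyVarying (f : ℝ → ℝ) : Prop :=
  (∃ X : ℝ, (∀ x ∈ Ici X, 0 < f x) ∧ Measurable fun x : Ici X => f x) ∧
    ∀ c : ℝ, 0 < c → Tendsto (fun x => f (c * x) / f x) atTop (𝓝 1)

open Classical in
/-- The Lebesgue-Stieltjes measure `dF` of a non-decreasing function `F : ℝ → ℝ`, which need not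
be right-continuous: `dF (a, b] = F (b+) - F (a+)`. It is set to `0` if `F` is not monotone. -/
def lsMeasure (F : ℝ → ℝ) : Measure ℝ :=
  if h : Monotone F then h.stieltjesFunction.measure else 0

/-- The bilateral Laplace-Stieltjes transform of `F` at `s`. -/
def lsTransform (F : ℝ → ℝ) (s : ℝ) : ℝ :=
  ∫ x, exp (-(s * x)) ∂(lsMeasure F)

/-- The double transform of a family `(G t)`, `t ≥ 0`: the Laplace transform in `t` of the
Laplace-Stieltjes transforms of the `G t`. -/
def doubleTransform (G : ℝ → ℝ → ℝ) (l s : ℝ) : ℝ :=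
  ∫ t in Ici (0 : ℝ), exp (-(l * t)) * lsTransform (G t) s

end

/-! Karamata's Tauberian theorem is used twice: in time, with a monotone density argument, and then
in space. The uniformity over x ≥ x_t costs nothing extra once it is read as convergence along
`windowFilter`, the filter of pairs (t, x) with t → ∞ and x ≥ x_t. The price is that both Tauberian
steps must hold for families of measures that vary with the index along an arbitrary filter;
Weierstrass approximation gives this without any selection of subsequences.

Put λ = k/t and s = p/x in the hypothesis. The condition on the window keeps s below a fixed
multiple of s_λ, and slow variation restores the normalization at (t, x)
(`tendsto_doubleTransform_windowFilter`). For fixed p, inverting in k gives the normalized transform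
of G_t at p/x, with limit p^(-α)/Γ(γ) (`tendsto_mul_density`). As this holds for all p > 0,
inverting in p gives the mass of dG_t to the left of x, with limit 1/(Γ(γ)Γ(α+1)). Large p shows
that the negative half-line is negligible. The masses of (-∞, x) and (-∞, x] have the same limit and
enclose G_t(x), so jumps do no harm. -/

open Filter Topology MeasureTheory Set Real

/-! ### Weierstrass approximation and continuity of Laplace transforms -/

/-- A function vanishing far to the right is `exp (-y)` times a continuous function of
`exp (-y)`. -/
theorem continuousOn_comp_neg_log_div {f : ℝ → ℝ} (hf : Continuous f) {R : ℝ}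
    (hR : ∀ y, R ≤ y → f y = 0) : ContinuousOn (fun u => f (-log u) / u) (Icc 0 1) := by
  intro u hu
  rcases hu.1.eq_or_lt with rfl | hu0
  · have hev : (fun u => f (-log u) / u) =ᶠ[𝓝[Icc 0 1] 0] fun _ => 0 := by
      have h1 : ∀ᶠ u in 𝓝[Icc (0 : ℝ) 1] 0, u < exp (-R) :=
        mem_nhdsWithin_of_mem_nhds (Iio_mem_nhds (exp_pos _))
      filter_upwards [h1, self_mem_nhdsWithin] with u hlt hmem
      rcases hmem.1.eq_or_lt with rfl | hpos
      · simp
      · have : log u < -R := (log_lt_iff_lt_exp hpos).2 hlt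
        rw [hR _ (by linarith), zero_div]
    exact (continuousWithinAt_const (b := (0 : ℝ))).congr_of_eventuallyEq hev (by simp)
  · exact ((hf.continuousAt.comp (continuousAt_log hu0.ne').neg).div continuousAt_id
      hu0.ne').continuousWithinAt

/-- Substitute u = exp (-y). Dividing by u beforehand leaves the weight exp (-y) in the error, which
keeps it integrable against infinite measures. -/
theorem abs_sub_exp_mul_eval_exp_le {f : ℝ → ℝ} {P : Polynomial ℝ} {η : ℝ}
    (hP : ∀ u ∈ Icc (0 : ℝ) 1, |P.eval u - f (-log u) / u| < η) {y : ℝ} (hy : 0 ≤ y) :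
    |f y - exp (-y) * P.eval (exp (-y))| ≤ η * exp (-y) := by
  have h := hP (exp (-y)) ⟨(exp_pos _).le, exp_le_one_iff.2 (by linarith)⟩
  rw [log_exp, neg_neg] at h
  have he := exp_pos (-y)
  have : f y - exp (-y) * P.eval (exp (-y)) =
      -(exp (-y) * (P.eval (exp (-y)) - f y / exp (-y))) := by
    field_simp
    ring
  rw [this, abs_neg, abs_mul, abs_of_pos he, mul_comm]
  exact mul_le_mul_of_nonneg_right h.le he.le

/-- The factor exp (-y) shifts every exponent by one, so the total mass (exponent 0), which may be
infinite, never appears. -/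
theorem exp_mul_eval_exp (P : Polynomial ℝ) (y : ℝ) :
    exp (-y) * P.eval (exp (-y)) =
      ∑ j ∈ Finset.range (P.natDegree + 1), P.coeff j * exp (-(((j + 1 : ℕ) : ℝ) * y)) := by
  rw [Polynomial.eval_eq_sum_range, Finset.mul_sum]
  refine Finset.sum_congr rfl fun j _ => ?_
  have : exp (-(((j + 1 : ℕ) : ℝ) * y)) = exp (-y) ^ j * exp (-y) := by
    rw [← pow_succ, ← exp_nat_mul]
    ring_nf
  rw [this]
  ring

theorem integrable_exp_mul_eval_exp {m : Measure ℝ} {P : Polynomial ℝ}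
    (hint : ∀ j ∈ Finset.range (P.natDegree + 1),
      Integrable (fun y => exp (-(((j + 1 : ℕ) : ℝ) * y))) m) :
    Integrable (fun y => exp (-y) * P.eval (exp (-y))) m := by
  simp_rw [exp_mul_eval_exp]
  exact integrable_finsetSum _ fun j hj => (hint j hj).const_mul _

theorem integral_exp_mul_eval_exp {m : Measure ℝ} {P : Polynomial ℝ}
    (hint : ∀ j ∈ Finset.range (P.natDegree + 1),
      Integrable (fun y => exp (-(((j + 1 : ℕ) : ℝ) * y))) m) :
    ∫ y, exp (-y) * P.eval (exp (-y)) ∂m =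
      ∑ j ∈ Finset.range (P.natDegree + 1),
        P.coeff j * ∫ y, exp (-(((j + 1 : ℕ) : ℝ) * y)) ∂m := by
  simp_rw [exp_mul_eval_exp]
  rw [integral_finsetSum _ fun j hj => (hint j hj).const_mul _]
  simp_rw [integral_const_mul]

theorem ae_nonneg_of_measure_Iio {m : Measure ℝ} (hsupp : m (Iio 0) = 0) : ∀ᵐ y ∂m, 0 ≤ y := by
  rw [ae_iff]
  simpa [not_le, Iio_def] using hsupp

/-- A continuous function vanishing far to the right is integrable against a measure on
`[0, ∞)` that integrates `exp (-y)`. -/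
theorem integrable_of_integrable_exp {m : Measure ℝ} (hsupp : m (Iio 0) = 0)
    (hint : Integrable (fun y => exp (-y)) m) {f : ℝ → ℝ} (hf : Continuous f) {R : ℝ}
    (hR : ∀ y, R ≤ y → f y = 0) : Integrable f m := by
  obtain ⟨C, hC⟩ := isCompact_Icc.exists_bound_of_continuousOn
    (continuousOn_comp_neg_log_div hf hR)
  refine (hint.const_mul C).mono' hf.aestronglyMeasurable ?_
  filter_upwards [ae_nonneg_of_measure_Iio hsupp] with y hy
  have h := hC (exp (-y)) ⟨(exp_pos _).le, exp_le_one_iff.2 (by linarith)⟩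
  rwa [log_exp, neg_neg, norm_div, norm_of_nonneg (exp_pos _).le, div_le_iff₀ (exp_pos _)] at h

theorem abs_integral_sub_le {m : Measure ℝ} (hsupp : m (Iio 0) = 0)
    (hint1 : Integrable (fun y => exp (-y)) m) {f : ℝ → ℝ} (hf : Continuous f) {R : ℝ}
    (hR : ∀ y, R ≤ y → f y = 0) {P : Polynomial ℝ} {η : ℝ}
    (hP : ∀ u ∈ Icc (0 : ℝ) 1, |P.eval u - f (-log u) / u| < η)
    (hint : ∀ j ∈ Finset.range (P.natDegree + 1),
      Integrable (fun y => exp (-(((j + 1 : ℕ) : ℝ) * y))) m) :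
    |∫ y, f y ∂m - ∑ j ∈ Finset.range (P.natDegree + 1),
        P.coeff j * ∫ y, exp (-(((j + 1 : ℕ) : ℝ) * y)) ∂m| ≤ η * ∫ y, exp (-y) ∂m := by
  rw [← integral_exp_mul_eval_exp hint, ← integral_sub (integrable_of_integrable_exp hsupp hint1
    hf hR) (integrable_exp_mul_eval_exp hint), ← integral_const_mul]
  refine norm_integral_le_of_norm_le (f := fun y => f y - exp (-y) * P.eval (exp (-y)))
    (hint1.const_mul η) ?_
  filter_upwards [ae_nonneg_of_measure_Iio hsupp] with y hy
  exact abs_sub_exp_mul_eval_exp_le hP hy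

/-- Continuity theorem for Laplace transforms at the positive integers. -/
theorem tendsto_integral_of_tendsto_laplace {ι : Type*} {F : Filter ι} {μ : ι → Measure ℝ}
    {ν : Measure ℝ} (hsupp : ∀ᶠ i in F, μ i (Iio 0) = 0) (hν : ν (Iio 0) = 0)
    (hint : ∀ k : ℕ, 1 ≤ k → ∀ᶠ i in F, Integrable (fun y => exp (-((k : ℝ) * y))) (μ i))
    (hνint : ∀ k : ℕ, 1 ≤ k → Integrable (fun y => exp (-((k : ℝ) * y))) ν)
    (hlim : ∀ k : ℕ, 1 ≤ k → Tendsto (fun i => ∫ y, exp (-((k : ℝ) * y)) ∂(μ i)) F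
      (𝓝 (∫ y, exp (-((k : ℝ) * y)) ∂ν)))
    {f : ℝ → ℝ} (hf : Continuous f) {R : ℝ} (hR : ∀ y, R ≤ y → f y = 0) :
    Tendsto (fun i => ∫ y, f y ∂(μ i)) F (𝓝 (∫ y, f y ∂ν)) := by
  have hint1 := hint 1 le_rfl
  have hνint1 := hνint 1 le_rfl
  have hlim1 := hlim 1 le_rfl
  simp only [Nat.cast_one, one_mul] at hint1 hνint1 hlim1
  set C := ∫ y, exp (-y) ∂ν
  have hC : 0 ≤ C := integral_nonneg fun y => (exp_pos _).le
  rw [Metric.tendsto_nhds]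
  intro e he
  -- The transforms at 1 are C in the limit and eventually below C + 1, so the two approximation
  -- errors add up to at most η(2C + 1) < e/2.
  set η := e / (2 * (2 * C + 2)) with hη
  have hη0 : 0 < η := by positivity
  obtain ⟨P, hP⟩ := exists_polynomial_near_of_continuousOn 0 1 _
    (continuousOn_comp_neg_log_div hf hR) η hη0
  have hsum : Tendsto (fun i => ∑ j ∈ Finset.range (P.natDegree + 1),
      P.coeff j * ∫ y, exp (-(((j + 1 : ℕ) : ℝ) * y)) ∂(μ i)) F
      (𝓝 (∑ j ∈ Finset.range (P.natDegree + 1),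
        P.coeff j * ∫ y, exp (-(((j + 1 : ℕ) : ℝ) * y)) ∂ν)) :=
    tendsto_finsetSum _ fun j _ => (hlim (j + 1) (by omega)).const_mul _
  have hall : ∀ᶠ i in F, ∀ j ∈ Finset.range (P.natDegree + 1),
      Integrable (fun y => exp (-(((j + 1 : ℕ) : ℝ) * y))) (μ i) :=
    (Filter.eventually_all_finset _).2 fun j _ => hint (j + 1) (by omega)
  filter_upwards [hsupp, hall, hint1, Metric.tendsto_nhds.1 hsum (e / 2) (by positivity),
    hlim1.eventually_lt_const (lt_add_one C)] with i h1 h2 h3 h4 h5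
  have a1 := abs_integral_sub_le h1 h3 hf hR hP h2
  have a2 := abs_integral_sub_le hν hνint1 hf hR hP fun j _ => hνint (j + 1) (by omega)
  have a3 : η * ∫ y, exp (-y) ∂(μ i) ≤ η * (C + 1) := by gcongr
  have a4 : η * (C + 1) + η * C < e / 2 := by
    have : η * (2 * C + 2) = e / 2 := by rw [hη]; field_simp
    nlinarith
  rw [Real.dist_eq] at h4 ⊢
  rw [abs_le] at a1 a2
  rw [abs_lt] at h4 ⊢
  constructor <;> linarith [a1.1, a1.2, a2.1, a2.2, h4.1, h4.2]

/-! ### The limit measure -/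

/-- The measure on `(0, ∞)` with density `c * y ^ (a - 1) / Γ(a)`. -/
noncomputable def rpowMeasure (c a : ℝ) : Measure ℝ :=
  (volume.restrict (Ioi 0)).withDensity fun y => ENNReal.ofReal (c / Gamma a * y ^ (a - 1))

theorem measurable_rpowMeasure_density (c a : ℝ) :
    Measurable fun y : ℝ => ENNReal.ofReal (c / Gamma a * y ^ (a - 1)) := by fun_prop

theorem rpowMeasure_Iio (c a : ℝ) : rpowMeasure c a (Iio 0) = 0 := by
  refine withDensity_absolutelyContinuous _ _ ?_
  rw [Measure.restrict_apply measurableSet_Iio, Iio_inter_Ioi, Ioo_self, measure_empty]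

theorem integral_rpowMeasure_exp {c a k : ℝ} (hc : 0 ≤ c) (ha : 0 < a) (hk : 0 < k) :
    ∫ y, exp (-(k * y)) ∂(rpowMeasure c a) = c * k ^ (-a) := by
  have hΓ := Gamma_pos_of_pos ha
  rw [rpowMeasure, integral_withDensity_eq_integral_toReal_smul₀
    (measurable_rpowMeasure_density c a).aemeasurable (by simp)]
  have : ∀ y ∈ Ioi (0 : ℝ), (ENNReal.ofReal (c / Gamma a * y ^ (a - 1))).toReal • exp (-(k * y))
      = c / Gamma a * (y ^ (a - 1) * exp (-(k * y))) := by
    intro y hy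
    have hy : 0 < y := hy
    rw [ENNReal.toReal_ofReal (by positivity), smul_eq_mul, mul_assoc]
  rw [setIntegral_congr_fun measurableSet_Ioi this, integral_const_mul,
    integral_rpow_mul_exp_neg_mul_Ioi ha hk, one_div, inv_rpow hk.le, rpow_neg hk.le]
  field_simp

theorem integrable_rpowMeasure_exp {c a k : ℝ} (hc : 0 < c) (ha : 0 < a) (hk : 0 < k) :
    Integrable (fun y => exp (-(k * y))) (rpowMeasure c a) := by
  -- A non-integrable function has integral 0 by convention, whereas the value computed above is
  -- positive.
  by_contra h
  have h1 := integral_rpowMeasure_exp hc.le ha hk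
  rw [integral_undef h] at h1
  have : 0 < c * k ^ (-a) := by positivity
  linarith

theorem rpowMeasure_Iic {c a x : ℝ} (hc : 0 ≤ c) (ha : 0 < a) (hx : 0 ≤ x) :
    (rpowMeasure c a).real (Iic x) = c * x ^ a / Gamma (a + 1) := by
  have hΓ := Gamma_pos_of_pos ha
  have hint : IntegrableOn (fun y : ℝ => c / Gamma a * y ^ (a - 1)) (Ioc 0 x) := by
    rw [← intervalIntegrable_iff_integrableOn_Ioc_of_le hx]
    exact (intervalIntegral.intervalIntegrable_rpow' (by linarith)).const_mul _
  have hnn : 0 ≤ᵐ[volume.restrict (Ioc 0 x)] fun y : ℝ => c / Gamma a * y ^ (a - 1) := by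
    filter_upwards [ae_restrict_mem measurableSet_Ioc] with y hy
    have := hy.1
    positivity
  have hI : ∫ y in Ioc 0 x, c / Gamma a * y ^ (a - 1) = c * x ^ a / Gamma (a + 1) := by
    rw [← intervalIntegral.integral_of_le hx, intervalIntegral.integral_const_mul,
      integral_rpow (Or.inl (by linarith)), Gamma_add_one ha.ne', sub_add_cancel,
      zero_rpow ha.ne', sub_zero]
    field_simp
  rw [Measure.real, rpowMeasure, withDensity_apply _ measurableSet_Iic,
    Measure.restrict_restrict measurableSet_Iic, inter_comm, Ioi_inter_Iic,
    ← ofReal_integral_eq_lintegral_ofReal hint hnn, ENNReal.toReal_ofReal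
    (integral_nonneg_of_ae hnn), hI]

/-! ### Continuous cutoffs between half-lines -/

/-- The continuous function that is `1` on `(-∞, u]`, `0` on `[v, ∞)` and affine between. -/
noncomputable def ramp (u v y : ℝ) : ℝ := max 0 (min 1 ((v - y) / (v - u)))

theorem continuous_ramp (u v : ℝ) : Continuous (ramp u v) := by
  unfold ramp
  fun_prop

theorem ramp_of_le {u v y : ℝ} (huv : u < v) (hy : y ≤ u) : ramp u v y = 1 := by
  have : 1 ≤ (v - y) / (v - u) := (one_le_div (by linarith)).2 (by linarith)
  rw [ramp, min_eq_left this, max_eq_right zero_le_one]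

theorem ramp_of_ge {u v y : ℝ} (huv : u < v) (hy : v ≤ y) : ramp u v y = 0 := by
  have : (v - y) / (v - u) ≤ 0 := div_nonpos_of_nonpos_of_nonneg (by linarith) (by linarith)
  rw [ramp, max_eq_left ((min_le_right _ _).trans this)]

theorem ramp_nonneg (u v y : ℝ) : 0 ≤ ramp u v y := le_max_left _ _

theorem ramp_le_one (u v y : ℝ) : ramp u v y ≤ 1 := max_le zero_le_one (min_le_left _ _)

section

variable {m : Measure ℝ} (hsupp : m (Iio 0) = 0) (hint : Integrable (fun y => exp (-y)) m)

include hsupp hint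

theorem integrable_ramp {u v : ℝ} (huv : u < v) : Integrable (ramp u v) m :=
  integrable_of_integrable_exp hsupp hint (continuous_ramp u v) fun _ => ramp_of_ge huv

theorem measure_Iic_ne_top_of_integrable_exp (x : ℝ) : m (Iic x) ≠ ⊤ := by
  refine ((measure_mono ?_).trans_lt ((integrable_ramp hsupp hint
    (lt_add_one x)).measure_norm_ge_lt_top zero_lt_one)).ne
  intro y hy
  rw [mem_ofPred_eq, ramp_of_le (lt_add_one x) hy, norm_one]

theorem measureReal_Iic_le_integral_ramp {u v : ℝ} (huv : u < v) :
    m.real (Iic u) ≤ ∫ y, ramp u v y ∂m := by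
  rw [← integral_indicator_one measurableSet_Iic]
  refine integral_mono ((integrable_indicator_iff measurableSet_Iic).2
    (integrableOn_const (measure_Iic_ne_top_of_integrable_exp hsupp hint u)))
    (integrable_ramp hsupp hint huv) fun y => ?_
  by_cases hy : y ∈ Iic u
  · simp [hy, ramp_of_le huv hy]
  · simp [hy, ramp_nonneg]

theorem integral_ramp_le_measureReal_Iio {u v : ℝ} (huv : u < v) :
    ∫ y, ramp u v y ∂m ≤ m.real (Iio v) := by
  rw [← integral_indicator_one measurableSet_Iio]
  refine integral_mono (integrable_ramp hsupp hint huv)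
    ((integrable_indicator_iff measurableSet_Iio).2 (integrableOn_const
    (measure_ne_top_of_subset Iio_subset_Iic_self
      (measure_Iic_ne_top_of_integrable_exp hsupp hint v)))) fun y => ?_
  by_cases hy : y ∈ Iio v
  · simp [hy, ramp_le_one]
  · simp [hy, ramp_of_ge huv (not_lt.1 hy)]

theorem measureReal_Iio_le_Iic (x : ℝ) : m.real (Iio x) ≤ m.real (Iic x) :=
  measureReal_mono Iio_subset_Iic_self (measure_Iic_ne_top_of_integrable_exp hsupp hint x)

end

/-! ### Karamata's theorem on the half-line -/

section

variable {ι : Type*} {F : Filter ι} {μ : ι → Measure ℝ} {c a : ℝ} (hc : 0 < c) (ha : 0 < a)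
  (hsupp : ∀ᶠ i in F, μ i (Iio 0) = 0)
  (hint : ∀ k : ℕ, 1 ≤ k → ∀ᶠ i in F, Integrable (fun y => exp (-((k : ℝ) * y))) (μ i))
  (hlim : ∀ k : ℕ, 1 ≤ k → Tendsto (fun i => ∫ y, exp (-((k : ℝ) * y)) ∂(μ i)) F
    (𝓝 (c * (k : ℝ) ^ (-a))))

include hc ha hsupp hint hlim

theorem tendsto_integral_ramp {u v : ℝ} (huv : u < v) :
    Tendsto (fun i => ∫ y, ramp u v y ∂(μ i)) F (𝓝 (∫ y, ramp u v y ∂(rpowMeasure c a))) := by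
  refine tendsto_integral_of_tendsto_laplace hsupp (rpowMeasure_Iio c a) hint
    (fun k hk => integrable_rpowMeasure_exp hc ha (by exact_mod_cast hk)) (fun k hk => ?_)
    (continuous_ramp u v) fun _ => ramp_of_ge huv
  rw [integral_rpowMeasure_exp hc.le ha (by exact_mod_cast hk)]
  exact hlim k hk

/-- Karamata's Tauberian theorem, with an arbitrary family of measures: lower bound. -/
theorem eventually_lt_measureReal_Iio {x b : ℝ} (hx : 0 < x)
    (hb : b < c * x ^ a / Gamma (a + 1)) : ∀ᶠ i in F, b < (μ i).real (Iio x) := by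
  have hcont : ContinuousAt (fun x : ℝ => c * x ^ a / Gamma (a + 1)) x :=
    ((continuousAt_rpow_const x a (Or.inl hx.ne')).const_mul c).div_const _
  -- The limit mass is continuous in its endpoint, so a cutoff starting at some u slightly below x
  -- still beats b.
  have hev : ∀ᶠ u in 𝓝[<] x, b < c * u ^ a / Gamma (a + 1) ∧ 0 < u ∧ u < x :=
    ((hcont.eventually (lt_mem_nhds hb)).filter_mono nhdsWithin_le_nhds).and
      (((lt_mem_nhds hx).filter_mono nhdsWithin_le_nhds).and self_mem_nhdsWithin)
  obtain ⟨u, hbu, hu0, hux⟩ := hev.exists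
  have hi := integrable_rpowMeasure_exp hc ha zero_lt_one
  have hi1 := hint 1 le_rfl
  simp only [Nat.cast_one, one_mul] at hi hi1
  have h1 := measureReal_Iic_le_integral_ramp (rpowMeasure_Iio c a) hi hux
  rw [rpowMeasure_Iic hc.le ha hu0.le] at h1
  filter_upwards [hsupp, hi1, (tendsto_integral_ramp hc ha hsupp hint hlim
    hux).eventually_const_lt (hbu.trans_le h1)] with i h2 h3 h4
  exact h4.trans_le (integral_ramp_le_measureReal_Iio h2 h3 hux)

/-- Karamata's Tauberian theorem, with an arbitrary family of measures: upper bound. -/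
theorem eventually_measureReal_Iic_lt {x b : ℝ} (hx : 0 < x)
    (hb : c * x ^ a / Gamma (a + 1) < b) : ∀ᶠ i in F, (μ i).real (Iic x) < b := by
  have hcont : ContinuousAt (fun x : ℝ => c * x ^ a / Gamma (a + 1)) x :=
    ((continuousAt_rpow_const x a (Or.inl hx.ne')).const_mul c).div_const _
  have hev : ∀ᶠ v in 𝓝[>] x, c * v ^ a / Gamma (a + 1) < b ∧ x < v :=
    ((hcont.eventually (gt_mem_nhds hb)).filter_mono nhdsWithin_le_nhds).and
      self_mem_nhdsWithin
  obtain ⟨v, hbv, hxv⟩ := hev.exists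
  have hi := integrable_rpowMeasure_exp hc ha zero_lt_one
  have hi1 := hint 1 le_rfl
  simp only [Nat.cast_one, one_mul] at hi hi1
  have h1 := (integral_ramp_le_measureReal_Iio (rpowMeasure_Iio c a) hi hxv).trans
    (measureReal_Iio_le_Iic (rpowMeasure_Iio c a) hi v)
  rw [rpowMeasure_Iic hc.le ha (hx.trans hxv).le] at h1
  filter_upwards [hsupp, hi1, (tendsto_integral_ramp hc ha hsupp hint hlim
    hxv).eventually_lt_const (h1.trans_lt hbv)] with i h2 h3 h4
  exact (measureReal_Iic_le_integral_ramp h2 h3 hxv).trans_lt h4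

theorem tendsto_measureReal_Iic {x : ℝ} (hx : 0 < x) :
    Tendsto (fun i => (μ i).real (Iic x)) F (𝓝 (c * x ^ a / Gamma (a + 1))) := by
  have hi1 := hint 1 le_rfl
  simp only [Nat.cast_one, one_mul] at hi1
  refine tendsto_order.2 ⟨fun b hb => ?_, fun b hb =>
    eventually_measureReal_Iic_lt hc ha hsupp hint hlim hx hb⟩
  filter_upwards [hsupp, hi1, eventually_lt_measureReal_Iio hc ha hsupp hint hlim hx hb]
    with i h1 h2 h3
  exact h3.trans_le (measureReal_Iio_le_Iic h1 h2 x)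

theorem tendsto_measureReal_Iio {x : ℝ} (hx : 0 < x) :
    Tendsto (fun i => (μ i).real (Iio x)) F (𝓝 (c * x ^ a / Gamma (a + 1))) := by
  have hi1 := hint 1 le_rfl
  simp only [Nat.cast_one, one_mul] at hi1
  refine tendsto_order.2 ⟨fun b hb =>
    eventually_lt_measureReal_Iio hc ha hsupp hint hlim hx hb, fun b hb => ?_⟩
  filter_upwards [hsupp, hi1, eventually_measureReal_Iic_lt hc ha hsupp hint hlim hx hb]
    with i h1 h2 h3
  exact (measureReal_Iio_le_Iic h1 h2 x).trans_lt h3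

end

/-! ### Bilateral transforms -/

theorem measure_Iic_ne_top_of_integrable_exp_mul {m : Measure ℝ} {p : ℝ} (hp : 0 ≤ p)
    (hint : Integrable (fun y => exp (-(p * y))) m) (x : ℝ) : m (Iic x) ≠ ⊤ := by
  refine ((measure_mono ?_).trans_lt (hint.measure_norm_ge_lt_top (exp_pos (-(p * x))))).ne
  intro y hy
  have hy : y ≤ x := hy
  rw [mem_ofPred_eq, norm_of_nonneg (exp_pos _).le]
  gcongr

section

variable {ι : Type*} {F : Filter ι} {μ : ι → Measure ℝ} {c a : ℝ} (ha : 0 < a)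
  (hint : ∀ p : ℝ, 0 < p → ∀ᶠ i in F, Integrable (fun y => exp (-(p * y))) (μ i))
  (hlim : ∀ p : ℝ, 0 < p → Tendsto (fun i => ∫ y, exp (-(p * y)) ∂(μ i)) F (𝓝 (c * p ^ (-a))))

include ha hint hlim

/-- The negative half-line does not contribute to the limit of the bilateral transforms. -/
theorem tendsto_setIntegral_Iio_exp {q : ℝ} :
    Tendsto (fun i => ∫ y in Iio 0, exp (-(q * y)) ∂(μ i)) F (𝓝 0) := by
  refine tendsto_order.2 ⟨fun b hb => Eventually.of_forall fun i =>
    hb.trans_le (integral_nonneg fun y => (exp_pos _).le), fun b hb => ?_⟩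
  -- For y < 0 and p ≥ q, exp (-qy) ≤ exp (-py). So the integral is at most the full transform at p,
  -- whose limit c p^(-a) is small for large p.
  have h0 : Tendsto (fun p : ℝ => c * p ^ (-a)) atTop (𝓝 0) := by
    simpa using (tendsto_rpow_neg_atTop ha).const_mul c
  obtain ⟨p, hpb, hp0, hpq⟩ := ((h0.eventually_lt_const hb).and
    ((eventually_gt_atTop 0).and (eventually_ge_atTop q))).exists
  filter_upwards [hint p hp0, (hlim p hp0).eventually_lt_const hpb] with i h1 h2
  refine lt_of_le_of_lt ?_ h2
  refine le_trans ?_ (setIntegral_le_integral (s := Iio 0) h1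
    (Eventually.of_forall fun y => (exp_pos _).le))
  refine integral_mono_of_nonneg (Eventually.of_forall fun y => (exp_pos _).le)
    h1.integrableOn ?_
  filter_upwards [ae_restrict_mem measurableSet_Iio] with y hy
  have hy : y < 0 := hy
  exact exp_le_exp.2 (by nlinarith)

theorem tendsto_measureReal_Iio_zero : Tendsto (fun i => (μ i).real (Iio 0)) F (𝓝 0) := by
  have h := tendsto_setIntegral_Iio_exp ha hint hlim (q := 0)
  simpa using h

theorem tendsto_setIntegral_Ici_exp {p : ℝ} (hp : 0 < p) :
    Tendsto (fun i => ∫ y in Ici 0, exp (-(p * y)) ∂(μ i)) F (𝓝 (c * p ^ (-a))) := by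
  have h := (hlim p hp).sub (tendsto_setIntegral_Iio_exp ha hint hlim (q := p))
  rw [sub_zero] at h
  refine h.congr' ?_
  filter_upwards [hint p hp] with i hi
  rw [← integral_add_compl measurableSet_Iio hi (s := Iio 0), compl_Iio]
  ring

/-- Cut s at 0: the part below 0 has vanishing mass, so the half-line theorem for the restricted
measures suffices. -/
theorem tendsto_measureReal_of_restrict {s : Set ℝ} {x b : ℝ} (hs : Iio 0 ⊆ s) (hsx : s ⊆ Iic x)
    (h : Tendsto (fun i => ((μ i).restrict (Ici 0)).real s) F (𝓝 b)) (hms : MeasurableSet s) :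
    Tendsto (fun i => (μ i).real s) F (𝓝 b) := by
  have h1 := (tendsto_measureReal_Iio_zero ha hint hlim).add h
  rw [zero_add] at h1
  refine h1.congr' ?_
  filter_upwards [hint 1 one_pos] with i hi
  have hfin : μ i s ≠ ⊤ :=
    measure_ne_top_of_subset hsx (measure_Iic_ne_top_of_integrable_exp_mul zero_le_one hi x)
  rw [measureReal_restrict_apply hms, ← measureReal_inter_add_sdiff (s := s)
    (measurableSet_Iio (a := (0 : ℝ))) hfin, inter_eq_right.2 hs, sdiff_eq, compl_Iio]

theorem tendsto_measureReal_Iic_of_bilateral (hc : 0 < c) {x : ℝ} (hx : 0 < x) :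
    Tendsto (fun i => (μ i).real (Iic x)) F (𝓝 (c * x ^ a / Gamma (a + 1))) := by
  refine tendsto_measureReal_of_restrict ha hint hlim (Iio_subset_Iic hx.le) subset_rfl
    (tendsto_measureReal_Iic hc ha (Eventually.of_forall fun i => ?_) (fun k hk => ?_)
      (fun k hk => tendsto_setIntegral_Ici_exp ha hint hlim (by exact_mod_cast hk)) hx)
    measurableSet_Iic
  · rw [Measure.restrict_apply measurableSet_Iio, Iio_inter_Ici, Ico_self, measure_empty]
  · filter_upwards [hint k (by exact_mod_cast hk)] with i hi using hi.integrableOn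

theorem tendsto_measureReal_Iio_of_bilateral (hc : 0 < c) {x : ℝ} (hx : 0 < x) :
    Tendsto (fun i => (μ i).real (Iio x)) F (𝓝 (c * x ^ a / Gamma (a + 1))) := by
  refine tendsto_measureReal_of_restrict ha hint hlim (Iio_subset_Iio hx.le) Iio_subset_Iic_self
    (tendsto_measureReal_Iio hc ha (Eventually.of_forall fun i => ?_) (fun k hk => ?_)
      (fun k hk => tendsto_setIntegral_Ici_exp ha hint hlim (by exact_mod_cast hk)) hx)
    measurableSet_Iio
  · rw [Measure.restrict_apply measurableSet_Iio, Iio_inter_Ici, Ico_self, measure_empty]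
  · filter_upwards [hint k (by exact_mod_cast hk)] with i hi using hi.integrableOn

end

/-! ### Rescaling of measures -/

/-- The measure `w • m`, with space rescaled by the factor `1 / r`. -/
noncomputable def rescale (w r : ℝ) (m : Measure ℝ) : Measure ℝ :=
  ENNReal.ofReal w • m.map fun y => y / r

theorem integrable_rescale_exp {w r p : ℝ} {m : Measure ℝ}
    (h : Integrable (fun y => exp (-(p / r * y))) m) :
    Integrable (fun y => exp (-(p * y))) (rescale w r m) := by
  refine Integrable.smul_measure ?_ ENNReal.ofReal_ne_top
  rw [integrable_map_measure (by fun_prop) (by fun_prop)]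
  refine h.congr (Eventually.of_forall fun y => ?_)
  simp only [Function.comp]
  ring_nf

theorem integral_rescale_exp {w r p : ℝ} {m : Measure ℝ} (hw : 0 ≤ w) :
    ∫ y, exp (-(p * y)) ∂(rescale w r m) = w * ∫ y, exp (-(p / r * y)) ∂m := by
  rw [rescale, integral_smul_measure, ENNReal.toReal_ofReal hw, smul_eq_mul,
    integral_map (by fun_prop) (by fun_prop)]
  congr 2
  ext y
  ring_nf

theorem rescale_real_Iic {w r x : ℝ} {m : Measure ℝ} (hw : 0 ≤ w) (hr : 0 < r) :
    (rescale w r m).real (Iic x) = w * m.real (Iic (r * x)) := by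
  have : (fun y => y / r) ⁻¹' Iic x = Iic (r * x) := by
    ext y
    simp [div_le_iff₀' hr]
  rw [rescale, measureReal_ennreal_smul_apply, ENNReal.toReal_ofReal hw,
    map_measureReal_apply (by fun_prop) measurableSet_Iic, this]

theorem rescale_real_Iio {w r x : ℝ} {m : Measure ℝ} (hw : 0 ≤ w) (hr : 0 < r) :
    (rescale w r m).real (Iio x) = w * m.real (Iio (r * x)) := by
  have : (fun y => y / r) ⁻¹' Iio x = Iio (r * x) := by
    ext y
    simp [div_lt_iff₀' hr]
  rw [rescale, measureReal_ennreal_smul_apply, ENNReal.toReal_ofReal hw,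
    map_measureReal_apply (by fun_prop) measurableSet_Iio, this]

section

variable {ι : Type*} {F : Filter ι} {m : ι → Measure ℝ} {w r : ι → ℝ} {c a : ℝ}
  (ha : 0 < a) (hc : 0 < c) (hw : ∀ᶠ i in F, 0 ≤ w i) (hr : ∀ᶠ i in F, 0 < r i)
  (hint : ∀ p : ℝ, 0 < p → ∀ᶠ i in F, Integrable (fun y => exp (-(p / r i * y))) (m i))
  (hlim : ∀ p : ℝ, 0 < p →
    Tendsto (fun i => w i * ∫ y, exp (-(p / r i * y)) ∂(m i)) F (𝓝 (c * p ^ (-a))))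

include ha hc hw hr hint hlim

/-- Karamata's Tauberian theorem for bilateral transforms of a family of measures. -/
theorem tendsto_mul_measureReal_Iic_of_bilateral :
    Tendsto (fun i => w i * (m i).real (Iic (r i))) F (𝓝 (c / Gamma (a + 1))) := by
  have h := tendsto_measureReal_Iic_of_bilateral (μ := fun i => rescale (w i) (r i) (m i)) ha
    (fun p hp => (hint p hp).mono fun i hi => integrable_rescale_exp hi)
    (fun p hp => (hlim p hp).congr' (hw.mono fun i hi => (integral_rescale_exp hi).symm))
    hc one_pos
  rw [one_rpow, mul_one] at h
  refine h.congr' ?_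
  filter_upwards [hw, hr] with i h1 h2
  rw [rescale_real_Iic h1 h2, mul_one]

theorem tendsto_mul_measureReal_Iio_of_bilateral :
    Tendsto (fun i => w i * (m i).real (Iio (r i))) F (𝓝 (c / Gamma (a + 1))) := by
  have h := tendsto_measureReal_Iio_of_bilateral (μ := fun i => rescale (w i) (r i) (m i)) ha
    (fun p hp => (hint p hp).mono fun i hi => integrable_rescale_exp hi)
    (fun p hp => (hlim p hp).congr' (hw.mono fun i hi => (integral_rescale_exp hi).symm))
    hc one_pos
  rw [one_rpow, mul_one] at h
  refine h.congr' ?_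
  filter_upwards [hw, hr] with i h1 h2
  rw [rescale_real_Iio h1 h2, mul_one]

end

/-! ### Monotone densities -/

/-- If the difference quotients at `1` of functions converging to `M` bound `g`, then `g`
converges to `M' 1`. -/
theorem tendsto_of_slope_bounds {ι : Type*} {F : Filter ι} {A : ι → ℝ → ℝ} {g : ι → ℝ}
    {M : ℝ → ℝ} {D : ℝ} (hM : HasDerivAt M D 1)
    (hA : ∀ x, 0 < x → Tendsto (fun i => A i x) F (𝓝 (M x)))
    (hup : ∀ y, 1 < y → ∀ᶠ i in F, g i ≤ slope (A i) 1 y)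
    (hlo : ∀ y, 0 < y → y < 1 → ∀ᶠ i in F, slope (A i) 1 y ≤ g i) :
    Tendsto g F (𝓝 D) := by
  have hs : ∀ y, 0 < y → Tendsto (fun i => slope (A i) 1 y) F (𝓝 (slope M 1 y)) := fun y hy => by
    simp_rw [slope_def_field]
    exact ((hA y hy).sub (hA 1 one_pos)).div_const _
  have hD := hasDerivAt_iff_tendsto_slope.1 hM
  refine tendsto_order.2 ⟨fun b hb => ?_, fun b hb => ?_⟩
  · have h1 : ∀ᶠ y in 𝓝[<] (1 : ℝ), b < slope M 1 y :=
      (hD.mono_left (nhdsWithin_mono _ fun y hy => ne_of_lt hy)).eventually_const_lt hb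
    obtain ⟨y, hby, hy0, hy1⟩ := (h1.and (((lt_mem_nhds one_pos).filter_mono
      nhdsWithin_le_nhds).and self_mem_nhdsWithin)).exists
    filter_upwards [hlo y hy0 hy1, (hs y hy0).eventually_const_lt hby] with i h2 h3
    exact h3.trans_le h2
  · have h1 : ∀ᶠ y in 𝓝[>] (1 : ℝ), slope M 1 y < b :=
      (hD.mono_left (nhdsWithin_mono _ fun y hy => ne_of_gt hy)).eventually_lt_const hb
    obtain ⟨y, hby, hy1⟩ := (h1.and self_mem_nhdsWithin).exists
    have hy1 : 1 < y := hy1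
    filter_upwards [hup y hy1, (hs y (one_pos.trans hy1)).eventually_lt_const hby] with i h2 h3
    exact h2.trans_lt h3

/-- The measure on `[0, ∞)` with density `h`. -/
noncomputable def densityMeasure (h : ℝ → ℝ) : Measure ℝ :=
  (volume.restrict (Ici 0)).withDensity fun x => ENNReal.ofReal (h x)

theorem densityMeasure_Iio (h : ℝ → ℝ) : densityMeasure h (Iio 0) = 0 := by
  refine withDensity_absolutelyContinuous _ _ ?_
  rw [Measure.restrict_apply measurableSet_Iio, Iio_inter_Ici, Ico_self, measure_empty]

section

variable {h : ℝ → ℝ} {l : ℝ} (hint : IntegrableOn (fun x => exp (-(l * x)) * h x) (Ici 0))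

include hint

/-- Multiplication by the continuous function exp (l x) undoes the weight and preserves local
integrability. -/
theorem locallyIntegrableOn_of_integrableOn_exp_mul : LocallyIntegrableOn h (Ici 0) := by
  have := hint.locallyIntegrableOn.continuousOn_mul (g := fun x => exp (l * x)) (by fun_prop)
    isClosed_Ici.isLocallyClosed
  have heq : (fun x => exp (l * x) * (exp (-(l * x)) * h x)) = h := by
    ext x
    rw [← mul_assoc, ← exp_add, add_neg_cancel, exp_zero, one_mul]
  rwa [heq] at this

theorem intervalIntegrable_of_integrableOn_exp_mul {x y : ℝ} (hx : 0 ≤ x) (hy : 0 ≤ y) :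
    IntervalIntegrable h volume x y := by
  rw [intervalIntegrable_iff']
  exact (locallyIntegrableOn_of_integrableOn_exp_mul hint).integrableOn_compact_subset
    (fun z hz => (le_inf hx hy).trans hz.1) isCompact_uIcc

theorem aemeasurable_of_integrableOn_exp_mul : AEMeasurable h (volume.restrict (Ici 0)) :=
  (locallyIntegrableOn_of_integrableOn_exp_mul hint).aestronglyMeasurable.aemeasurable

variable (hnn : ∀ x, 0 ≤ x → 0 ≤ h x)

include hnn

theorem integrable_densityMeasure_exp :
    Integrable (fun x => exp (-(l * x))) (densityMeasure h) := by
  rw [densityMeasure, integrable_withDensity_iff_integrable_smul₀'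
    (aemeasurable_of_integrableOn_exp_mul hint).ennreal_ofReal (by simp)]
  refine hint.congr_fun (fun x hx => ?_) measurableSet_Ici
  rw [ENNReal.toReal_ofReal (hnn x hx), smul_eq_mul, mul_comm]

theorem integral_densityMeasure_exp :
    ∫ x, exp (-(l * x)) ∂(densityMeasure h) = ∫ x in Ici 0, exp (-(l * x)) * h x := by
  rw [densityMeasure, integral_withDensity_eq_integral_toReal_smul₀
    (aemeasurable_of_integrableOn_exp_mul hint).ennreal_ofReal (by simp)]
  refine setIntegral_congr_fun measurableSet_Ici fun x hx => ?_
  rw [ENNReal.toReal_ofReal (hnn x hx), smul_eq_mul, mul_comm]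

theorem densityMeasure_real_Iic {x : ℝ} (hx : 0 ≤ x) :
    (densityMeasure h).real (Iic x) = ∫ y in (0 : ℝ)..x, h y := by
  have hi := (intervalIntegrable_iff_integrableOn_Icc_of_le hx).1
    (intervalIntegrable_of_integrableOn_exp_mul hint le_rfl hx)
  have h0 : 0 ≤ᵐ[volume.restrict (Icc 0 x)] h := by
    filter_upwards [ae_restrict_mem measurableSet_Icc] with y hy using hnn y hy.1
  rw [Measure.real, densityMeasure, withDensity_apply _ measurableSet_Iic,
    Measure.restrict_restrict measurableSet_Iic, inter_comm, Ici_inter_Iic,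
    ← ofReal_integral_eq_lintegral_ofReal hi h0, ENNReal.toReal_ofReal
    (integral_nonneg_of_ae h0), integral_Icc_eq_integral_Ioc,
    intervalIntegral.integral_of_le hx]

omit hnn

/-- The slope is w times the mean of h over [t, t y], where h is at least h t. -/
theorem mul_le_slope_of_monotoneOn {T w t y : ℝ} (hmono : MonotoneOn h (Ici T))
    (hw : 0 ≤ w) (ht : 0 < t) (hTt : T ≤ t) (hy : 1 < y) :
    w * h t ≤ slope (fun x => w / t * ∫ τ in (0 : ℝ)..t * x, h τ) 1 y := by
  have hty : t ≤ t * y := le_mul_of_one_le_right ht.le hy.le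
  have hle : (t * y - t) * h t ≤ ∫ τ in t..t * y, h τ := by
    rw [← smul_eq_mul, ← intervalIntegral.integral_const]
    exact intervalIntegral.integral_mono_on hty intervalIntegrable_const
      (intervalIntegrable_of_integrableOn_exp_mul hint ht.le (ht.le.trans hty))
      fun z hz => hmono hTt (hTt.trans hz.1) hz.1
  rw [slope_def_field, ← mul_sub, mul_one, intervalIntegral.integral_interval_sub_left
    (intervalIntegrable_of_integrableOn_exp_mul hint le_rfl (ht.le.trans hty))
    (intervalIntegrable_of_integrableOn_exp_mul hint le_rfl ht.le), le_div_iff₀ (by linarith)]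
  calc w * h t * (y - 1) = w / t * ((t * y - t) * h t) := by field_simp
    _ ≤ _ := by gcongr

/-- The mean is now over [t y, t]. Monotonicity is needed from t y on, whence the condition T ≤ t y,
which holds eventually for fixed y when T is fixed. -/
theorem slope_le_mul_of_monotoneOn {T w t y : ℝ} (hmono : MonotoneOn h (Ici T))
    (hw : 0 ≤ w) (ht : 0 < t) (hTt : T ≤ t * y) (hy0 : 0 < y) (hy : y < 1) :
    slope (fun x => w / t * ∫ τ in (0 : ℝ)..t * x, h τ) 1 y ≤ w * h t := by
  have hty : t * y ≤ t := mul_le_of_le_one_right ht.le hy.le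
  have hty0 : 0 ≤ t * y := by positivity
  have hle : ∫ τ in t * y..t, h τ ≤ (t - t * y) * h t := by
    rw [← smul_eq_mul (t - t * y), ← intervalIntegral.integral_const]
    exact intervalIntegral.integral_mono_on hty
      (intervalIntegrable_of_integrableOn_exp_mul hint hty0 ht.le) intervalIntegrable_const
      fun z hz => hmono (hTt.trans hz.1) (hTt.trans hty) hz.2
  rw [slope_comm, slope_def_field, ← mul_sub, mul_one, intervalIntegral.integral_interval_sub_left
    (intervalIntegrable_of_integrableOn_exp_mul hint le_rfl ht.le)
    (intervalIntegrable_of_integrableOn_exp_mul hint le_rfl hty0), div_le_iff₀ (by linarith)]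
  calc _ ≤ w / t * ((t - t * y) * h t) := by gcongr
    _ = w * h t * (1 - y) := by field_simp

end

theorem hasDerivAt_mul_rpow_div_Gamma (c : ℝ) {a : ℝ} (ha : 0 < a) :
    HasDerivAt (fun x : ℝ => c * x ^ a / Gamma (a + 1)) (c / Gamma a) 1 := by
  have h := ((hasDerivAt_rpow_const (x := 1) (p := a) (Or.inl one_ne_zero)).const_mul c).div_const
    (Gamma (a + 1))
  refine h.congr_deriv ?_
  rw [one_rpow, mul_one, Gamma_add_one ha.ne']
  have := (Gamma_pos_of_pos ha).ne'
  field_simp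

/-- Karamata's Tauberian theorem with the monotone density theorem, for a family of densities
whose Laplace transforms are controlled at the integer multiples of `1 / t`. -/
theorem tendsto_mul_density {ι : Type*} {F : Filter ι} {h : ι → ℝ → ℝ} {w t : ι → ℝ} {c a T : ℝ}
    (ha : 0 < a) (hc : 0 < c) (hw : ∀ᶠ i in F, 0 ≤ w i) (ht : Tendsto t F atTop)
    (hnn : ∀ i x, 0 ≤ x → 0 ≤ h i x) (hmono : ∀ᶠ i in F, MonotoneOn (h i) (Ici T))
    (hint : ∀ᶠ i in F, ∀ l, 0 < l → IntegrableOn (fun x => exp (-(l * x)) * h i x) (Ici 0))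
    (hlim : ∀ k : ℕ, 1 ≤ k → Tendsto
      (fun i => w i / t i * ∫ x in Ici 0, exp (-((k : ℝ) / t i * x)) * h i x) F
      (𝓝 (c * (k : ℝ) ^ (-a)))) :
    Tendsto (fun i => w i * h i (t i)) F (𝓝 (c / Gamma a)) := by
  have ht0 : ∀ᶠ i in F, 0 < t i := ht.eventually_gt_atTop 0
  have hA : ∀ x, 0 < x → Tendsto (fun i => w i / t i * ∫ τ in (0 : ℝ)..t i * x, h i τ) F
      (𝓝 (c * x ^ a / Gamma (a + 1))) := by
    intro x hx
    have hres := tendsto_measureReal_Iic (F := F) hc ha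
      (μ := fun i => rescale (w i / t i) (t i) (densityMeasure (h i)))
      (ht0.mono fun i hi => ?_) (fun k hk => ?_) (fun k hk => ?_) hx
    · refine hres.congr' ?_
      filter_upwards [hw, ht0, hint] with i h1 h2 h3
      rw [rescale_real_Iic (by positivity) h2, densityMeasure_real_Iic (h3 1 one_pos) (hnn i)
        (by positivity)]
    · have : (fun y => y / t i) ⁻¹' Iio 0 = Iio 0 := by
        ext y
        simp [div_lt_iff₀ hi]
      rw [rescale, Measure.smul_apply, Measure.map_apply (by fun_prop) measurableSet_Iio, this,
        densityMeasure_Iio, smul_zero]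
    · have hk0 : (0 : ℝ) < k := by exact_mod_cast hk
      filter_upwards [ht0, hint] with i h2 h3
      exact integrable_rescale_exp (integrable_densityMeasure_exp (h3 _ (by positivity)) (hnn i))
    · have hk0 : (0 : ℝ) < k := by exact_mod_cast hk
      refine (hlim k hk).congr' ?_
      filter_upwards [hw, ht0, hint] with i h1 h2 h3
      rw [integral_rescale_exp (by positivity), integral_densityMeasure_exp
        (h3 _ (by positivity)) (hnn i)]
  refine tendsto_of_slope_bounds (hasDerivAt_mul_rpow_div_Gamma c ha) hA (fun y hy => ?_)
    fun y hy0 hy => ?_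
  · filter_upwards [hw, ht0, hint, hmono, ht.eventually_ge_atTop T] with i h1 h2 h3 h4 h5
    exact mul_le_slope_of_monotoneOn (h3 1 one_pos) h4 h1 h2 h5 hy
  · filter_upwards [hw, ht0, hint, hmono, (ht.atTop_mul_const hy0).eventually_ge_atTop T]
      with i h1 h2 h3 h4 h5
    exact slope_le_mul_of_monotoneOn (h3 1 one_pos) h4 h1 h2 h5 hy0 hy

/-! ### Uniform convergence as convergence along filters -/

theorem Filter.Tendsto.of_iSup_ofReal_abs {ι β γ : Type*} {F : Filter ι} {A : Filter β}
    {g : β → γ → ℝ} {S : β → Set γ}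
    (h : Tendsto (fun l => ⨆ s ∈ S l, ENNReal.ofReal |g l s|) A (𝓝 0))
    {a : ι → β} {b : ι → γ} (ha : Tendsto a F A) (hb : ∀ᶠ i in F, b i ∈ S (a i)) :
    Tendsto (fun i => g (a i) (b i)) F (𝓝 0) := by
  have h1 : Tendsto (fun i => ENNReal.ofReal |g (a i) (b i)|) F (𝓝 0) :=
    tendsto_of_tendsto_of_tendsto_of_le_of_le' tendsto_const_nhds (h.comp ha)
      (Eventually.of_forall fun _ => zero_le) (hb.mono fun i hi =>
        le_iSup₂ (f := fun s (_ : s ∈ S (a i)) => ENNReal.ofReal |g (a i) s|) (b i) hi)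
  have h2 := (ENNReal.tendsto_toReal ENNReal.zero_ne_top).comp h1
  rw [ENNReal.toReal_zero] at h2
  refine (tendsto_zero_iff_abs_tendsto_zero _).2 (h2.congr fun i => ?_)
  simp only [Function.comp, ENNReal.toReal_ofReal (abs_nonneg _)]

/-- The filter is the coarsest one whose first coordinate follows A and whose second lies in S, so
an eventual bound along it holds for all s in S l at once. -/
theorem tendsto_iSup_ofReal_abs {β γ : Type*} {A : Filter β} {g : β → γ → ℝ} {S : β → Set γ}
    (h : Tendsto (fun q : β × γ => g q.1 q.2) (comap Prod.fst A ⊓ 𝓟 {q | q.2 ∈ S q.1}) (𝓝 0)) :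
    Tendsto (fun l => ⨆ s ∈ S l, ENNReal.ofReal |g l s|) A (𝓝 0) := by
  have h1 : Tendsto (fun q : β × γ => ENNReal.ofReal |g q.1 q.2|)
      (comap Prod.fst A ⊓ 𝓟 {q | q.2 ∈ S q.1}) (𝓝 0) := by
    have := ENNReal.tendsto_ofReal h.abs
    rwa [abs_zero, ENNReal.ofReal_zero] at this
  refine ENNReal.tendsto_nhds_zero.2 fun ε hε => ?_
  have h2 := eventually_comap.1 (eventually_inf_principal.1 (ENNReal.tendsto_nhds_zero.1 h1 ε hε))
  filter_upwards [h2] with l hl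
  exact iSup₂_le fun s hs => hl (l, s) rfl hs

/-! ### Non-decreasing functions and their Stieltjes measures -/

section

variable {F : ℝ → ℝ}

theorem tendsto_stieltjesFunction_atBot (hF : Monotone F) (h0 : Tendsto F atBot (𝓝 0)) :
    Tendsto hF.stieltjesFunction atBot (𝓝 0) := by
  have h1 : Tendsto (fun x => F (x + 1)) atBot (𝓝 0) :=
    h0.comp (tendsto_atBot_add_const_right _ 1 tendsto_id)
  refine tendsto_of_tendsto_of_tendsto_of_le_of_le h0 h1 (fun x => ?_) fun x => ?_
  · rw [hF.stieltjesFunction_eq]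
    exact hF.le_rightLim le_rfl
  · rw [hF.stieltjesFunction_eq]
    exact hF.rightLim_le (lt_add_one x)

theorem nonneg_of_monotone_of_tendsto_atBot (hF : Monotone F) (h0 : Tendsto F atBot (𝓝 0))
    (x : ℝ) : 0 ≤ F x :=
  le_of_tendsto h0 ((eventually_le_atBot x).mono fun _ hy => hF hy)

/-- The mass of (-∞, x] is the right limit F(x+); that of (-∞, x) in the next lemma is F(x-). -/
theorem le_lsMeasure_real_Iic (hF : Monotone F) (h0 : Tendsto F atBot (𝓝 0)) (x : ℝ) :
    F x ≤ (lsMeasure F).real (Iic x) := by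
  rw [lsMeasure, dif_pos hF, Measure.real, StieltjesFunction.measure_Iic _
    (tendsto_stieltjesFunction_atBot hF h0), sub_zero, hF.stieltjesFunction_eq,
    ENNReal.toReal_ofReal']
  exact (hF.le_rightLim le_rfl).trans (le_max_left _ _)

theorem lsMeasure_real_Iio_le (hF : Monotone F) (h0 : Tendsto F atBot (𝓝 0)) (x : ℝ) :
    (lsMeasure F).real (Iio x) ≤ F x := by
  rw [lsMeasure, dif_pos hF, Measure.real, StieltjesFunction.measure_Iio _
    (tendsto_stieltjesFunction_atBot hF h0), sub_zero,
    ENNReal.toReal_ofReal']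
  refine max_le ?_ (nonneg_of_monotone_of_tendsto_atBot hF h0 x)
  refine le_of_tendsto (hF.stieltjesFunction.mono.tendsto_leftLim x) ?_
  filter_upwards [self_mem_nhdsWithin] with y hy
  rw [hF.stieltjesFunction_eq]
  exact hF.rightLim_le hy

end

theorem lsTransform_nonneg (F : ℝ → ℝ) (s : ℝ) : 0 ≤ lsTransform F s :=
  integral_nonneg fun _ => (exp_pos _).le

theorem IsSlowlyVarying.eventually_pos {f : ℝ → ℝ} (hf : IsSlowlyVarying f) :
    ∀ᶠ x in atTop, 0 < f x := by
  obtain ⟨X, hX, -⟩ := hf.1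
  exact (eventually_ge_atTop X).mono hX

/-! ### The window of pairs (t, x) -/

/-- The pairs `(t, x)` with `t → ∞` and `x ≥ 1 / σ (1 / t)`. -/
def windowFilter (σ : ℝ → ℝ) : Filter (ℝ × ℝ) :=
  comap Prod.fst atTop ⊓ 𝓟 {q | q.2 ∈ Ici (1 / σ (1 / q.1))}

section

variable {σ : ℝ → ℝ} (hσpos : ∀ l, 0 < l → 0 < σ l)

theorem tendsto_fst_windowFilter (σ : ℝ → ℝ) : Tendsto Prod.fst (windowFilter σ) atTop :=
  tendsto_comap.mono_left inf_le_left

theorem eventually_window (σ : ℝ → ℝ) : ∀ᶠ q in windowFilter σ, 1 / σ (1 / q.1) ≤ q.2 :=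
  mem_inf_of_right (mem_principal_self _)

theorem tendsto_div_fst_windowFilter (σ : ℝ → ℝ) {k : ℝ} (hk : 0 < k) :
    Tendsto (fun q : ℝ × ℝ => k / q.1) (windowFilter σ) (𝓝[>] 0) := by
  have ht := tendsto_fst_windowFilter σ
  refine tendsto_nhdsWithin_iff.2 ⟨ht.const_div_atTop k, ?_⟩
  filter_upwards [ht.eventually_gt_atTop 0] with q hq using div_pos hk hq

include hσpos

theorem tendsto_snd_windowFilter (hσlim : Tendsto σ (𝓝[>] 0) (𝓝 0)) :
    Tendsto Prod.snd (windowFilter σ) atTop := by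
  have h1 := tendsto_div_fst_windowFilter σ one_pos
  have h2 : Tendsto (fun q : ℝ × ℝ => σ (1 / q.1)) (windowFilter σ) (𝓝[>] 0) := by
    refine tendsto_nhdsWithin_iff.2 ⟨hσlim.comp h1, ?_⟩
    filter_upwards [h1.eventually self_mem_nhdsWithin] with q hq using hσpos _ hq
  refine tendsto_atTop_mono' _ (eventually_window σ) ?_
  exact h2.inv_tendsto_nhdsGT_zero.congr fun q => (one_div _).symm

/-- In the window p/x ≤ p σ(1/t), while the hypothesis at λ = k/t requires a multiple of σ(k/t). The
O-condition provides the constant C, and θ = p C. -/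
theorem exists_eventually_mem_window {k : ℕ} (hk : 1 ≤ k)
    (hσreg : σ =O[𝓝[>] 0] fun l => σ (k * l)) {p : ℝ} (hp : 0 < p) :
    ∃ θ > 0, ∀ᶠ q in windowFilter σ, p / q.2 ∈ Ioc 0 (θ * σ (k / q.1)) := by
  obtain ⟨C, hC, hb⟩ := hσreg.exists_pos
  have hk0 : (0 : ℝ) < k := by exact_mod_cast hk
  refine ⟨p * C, by positivity, ?_⟩
  filter_upwards [(tendsto_div_fst_windowFilter σ one_pos).eventually hb.bound,
    eventually_window σ, (tendsto_fst_windowFilter σ).eventually_gt_atTop 0] with q h1 h2 h3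
  have hs : 0 < σ (1 / q.1) := hσpos _ (by positivity)
  have hs' : 0 < σ (k / q.1) := hσpos _ (by positivity)
  rw [mul_one_div, norm_of_nonneg hs.le, norm_of_nonneg hs'.le] at h1
  have hx : 0 < q.2 := (one_div_pos.2 hs).trans_le h2
  refine ⟨by positivity, ?_⟩
  have h4 : 1 / q.2 ≤ σ (1 / q.1) := (one_div_le hs hx).1 h2
  calc p / q.2 = p * (1 / q.2) := by ring
    _ ≤ p * (C * σ (k / q.1)) := by gcongr; exact h4.trans h1
    _ = _ := by ring

end

/-! ### The hypothesis along the window -/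

/-- The algebraic identity behind the change of the scale in the normalization. -/
theorem normalization_ratio {k p t x α γ L L' ℓ ℓ' : ℝ} (hk : 0 < k) (hp : 0 < p) (ht : 0 < t)
    (hx : 0 < x) (hL : 0 < L) (hL' : 0 < L') (hℓ : 0 < ℓ) (hℓ' : 0 < ℓ') (D : ℝ) :
    D / (L' * (k / t) ^ (-γ) * (p / x) ^ (-α) * ℓ') *
      (L' / L * (ℓ' / ℓ) * (p ^ (-α) * k ^ (-γ))) =
      1 / (L * t ^ (γ - 1) * ℓ * x ^ α) / t * D := by
  have h1 : (k / t) ^ (-γ) = k ^ (-γ) * t ^ γ := by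
    rw [div_rpow hk.le ht.le, rpow_neg ht.le, div_inv_eq_mul]
  have h2 : (p / x) ^ (-α) = p ^ (-α) * x ^ α := by
    rw [div_rpow hp.le hx.le, rpow_neg hx.le, div_inv_eq_mul]
  have h3 : t ^ γ = t ^ (γ - 1) * t := by
    rw [rpow_sub_one ht.ne', div_mul_cancel₀ _ ht.ne']
  rw [h1, h2, h3]
  have a1 : 0 < k ^ (-γ) := by positivity
  have a2 : 0 < p ^ (-α) := by positivity
  have a3 : 0 < t ^ (γ - 1) := by positivity
  have a4 : 0 < x ^ α := by positivity
  field_simp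

section

variable {G : ℝ → ℝ → ℝ} {σ : ℝ → ℝ} (hσpos : ∀ l, 0 < l → 0 < σ l)
  (hσlim : Tendsto σ (𝓝[>] 0) (𝓝 0))
  (hσreg : ∀ k : ℕ, 1 ≤ k → σ =O[𝓝[>] 0] fun l => σ (k * l))
  {α γ : ℝ} {ℓ L : ℝ → ℝ} (hℓ : IsSlowlyVarying ℓ) (hL : IsSlowlyVarying L)
  (hyp : ∀ θ : ℝ, 0 < θ →
    Tendsto
      (fun l : ℝ => ⨆ s ∈ Ioc 0 (θ * σ l),
        ENNReal.ofReal
          |doubleTransform G l s / (L (1 / l) * l ^ (-γ) * s ^ (-α) * ℓ (1 / s)) - 1|)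
      (𝓝[>] 0) (𝓝 0))

include hσpos hσlim hσreg hℓ hL hyp

theorem tendsto_doubleTransform_windowFilter {k : ℕ} (hk : 1 ≤ k) {p : ℝ} (hp : 0 < p) :
    Tendsto (fun q : ℝ × ℝ => 1 / (L q.1 * q.1 ^ (γ - 1) * ℓ q.2 * q.2 ^ α) / q.1 *
      doubleTransform G (k / q.1) (p / q.2)) (windowFilter σ)
      (𝓝 (p ^ (-α) * (k : ℝ) ^ (-γ))) := by
  have hk0 : (0 : ℝ) < k := by exact_mod_cast hk
  obtain ⟨θ, hθ, hmem⟩ := exists_eventually_mem_window hσpos hk (hσreg k hk) hp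
  have h1 := (hyp θ hθ).of_iSup_ofReal_abs (tendsto_div_fst_windowFilter σ hk0) hmem
  replace h1 := h1.add_const 1
  simp only [sub_add_cancel, zero_add, one_div_div] at h1
  have ht := tendsto_fst_windowFilter σ
  have hx := tendsto_snd_windowFilter hσpos hσlim
  -- At λ = k/t and s = p/x the slowly varying factors are L(t/k) and ℓ(x/p); their ratios to L(t)
  -- and ℓ(x) tend to 1.
  have hLk := (hL.2 (1 / k) (by positivity)).comp ht
  have hℓp := (hℓ.2 (1 / p) (by positivity)).comp hx
  have h2 := h1.mul ((hLk.mul hℓp).mul_const (p ^ (-α) * (k : ℝ) ^ (-γ)))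
  simp only [one_mul, Function.comp, one_div_mul_eq_div] at h2
  refine h2.congr' ?_
  filter_upwards [ht.eventually_gt_atTop 0, hx.eventually_gt_atTop 0,
    ht.eventually hL.eventually_pos, hx.eventually hℓ.eventually_pos,
    (ht.atTop_div_const hk0).eventually hL.eventually_pos,
    (hx.atTop_div_const hp).eventually hℓ.eventually_pos] with q b1 b2 b3 b4 b5 b6
  exact normalization_ratio hk0 hp b1 b2 b3 b5 b4 b6 _

end

/-! ### The two inversions combined -/

theorem theorem1
    (G : ℝ → ℝ → ℝ) (ε : ℝ) (hε : 0 < ε)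
    -- each `G t` is non-decreasing and vanishes at `-∞`
    (hmono : ∀ t, 0 ≤ t → Monotone (G t))
    (hbot : ∀ t, 0 ≤ t → Tendsto (G t) atBot (𝓝 0))
    -- the Laplace-Stieltjes transforms exist on `(0, ε)`
    (hG : ∀ t, 0 ≤ t → ∀ s ∈ Ioo 0 ε,
      Integrable (fun x => exp (-(s * x))) (lsMeasure (G t)))
    -- the double transform is well-defined for every `l > 0`
    (hGG : ∀ l, 0 < l → ∀ s ∈ Ioo 0 ε,
      IntegrableOn (fun t => exp (-(l * t)) * lsTransform (G t) s) (Ici 0))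
    -- the transforms are non-decreasing in `t`, from some `T ≥ 0` on that does not depend on `s`
    (T : ℝ) (hT : 0 ≤ T)
    (hmonot : ∀ s ∈ Ioo 0 ε, MonotoneOn (fun t => lsTransform (G t) s) (Ici T))
    -- the window `σ l`, that is `s_λ` with `λ = l`
    (σ : ℝ → ℝ) (hσpos : ∀ l, 0 < l → 0 < σ l) (hσlim : Tendsto σ (𝓝[>] 0) (𝓝 0))
    (hσreg : ∀ k : ℕ, 1 ≤ k → σ =O[𝓝[>] 0] fun l => σ (k * l))
    (α γ : ℝ) (hα : 0 < α) (hγ : 1 < γ)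
    (ℓ L : ℝ → ℝ) (hℓ : IsSlowlyVarying ℓ) (hL : IsSlowlyVarying L)
    (hyp : ∀ θ : ℝ, 0 < θ →
      Tendsto
        (fun l : ℝ => ⨆ s ∈ Ioc 0 (θ * σ l),
          ENNReal.ofReal
            |doubleTransform G l s / (L (1 / l) * l ^ (-γ) * s ^ (-α) * ℓ (1 / s)) - 1|)
        (𝓝[>] 0) (𝓝 0)) :
    Tendsto
      (fun t : ℝ => ⨆ x ∈ Ici (1 / σ (1 / t)),
        ENNReal.ofReal
          |Gamma γ * Gamma (α + 1) * (G t x / (L t * t ^ (γ - 1) * ℓ x * x ^ α)) - 1|)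
      atTop (𝓝 0) := by
  refine tendsto_iSup_ofReal_abs (S := fun t => Ici (1 / σ (1 / t))) (g := fun t x =>
    Gamma γ * Gamma (α + 1) * (G t x / (L t * t ^ (γ - 1) * ℓ x * x ^ α)) - 1) ?_
  change Tendsto _ (windowFilter σ) _
  have ht := tendsto_fst_windowFilter σ
  have hx := tendsto_snd_windowFilter hσpos hσlim
  have ht0 := ht.eventually_ge_atTop 0
  have hx0 := hx.eventually_gt_atTop 0
  set w : ℝ × ℝ → ℝ := fun q => 1 / (L q.1 * q.1 ^ (γ - 1) * ℓ q.2 * q.2 ^ α) with hw_def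
  have hw : ∀ᶠ q in windowFilter σ, 0 ≤ w q := by
    filter_upwards [ht0, hx0, ht.eventually hL.eventually_pos,
      hx.eventually hℓ.eventually_pos] with q h1 h2 h3 h4
    positivity
  have hs : ∀ p : ℝ, 0 < p → ∀ᶠ q : ℝ × ℝ in windowFilter σ, p / q.2 ∈ Ioo 0 ε := by
    intro p hp
    filter_upwards [hx0, (hx.const_div_atTop p).eventually_lt_const hε] with q h1 h2
    exact ⟨by positivity, h2⟩
  have hγ0 : 0 < γ := by linarith
  have hΓγ := Gamma_pos_of_pos hγ0
  have hΓα : 0 < Gamma (α + 1) := Gamma_pos_of_pos (by linarith)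
  have hlim : ∀ p : ℝ, 0 < p → Tendsto (fun q : ℝ × ℝ => w q * lsTransform (G q.1) (p / q.2))
      (windowFilter σ) (𝓝 (1 / Gamma γ * p ^ (-α))) := by
    intro p hp
    -- Inversion in time with p fixed: the densities τ ↦ Ĝ_τ(p/x) depend on x, hence on the index q.
    have h := tendsto_mul_density (h := fun (q : ℝ × ℝ) τ => lsTransform (G τ) (p / q.2))
      (T := T) (c := p ^ (-α)) hγ0 (by positivity) hw ht (fun q τ _ => lsTransform_nonneg _ _)
      ((hs p hp).mono fun q hq => hmonot _ hq)
      ((hs p hp).mono fun q hq l hl => hGG l hl _ hq)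
      fun k hk => tendsto_doubleTransform_windowFilter hσpos hσlim hσreg hℓ hL hyp hk hp
    rwa [div_eq_inv_mul, ← one_div] at h
  have hint : ∀ p : ℝ, 0 < p → ∀ᶠ q : ℝ × ℝ in windowFilter σ,
      Integrable (fun y => exp (-(p / q.2 * y))) (lsMeasure (G q.1)) := by
    intro p hp
    filter_upwards [ht0, hs p hp] with q h1 h2 using hG q.1 h1 _ h2
  -- Inversion in space, with scale r = x and constant c = 1/Γ(γ).
  have hup := tendsto_mul_measureReal_Iic_of_bilateral hα (by positivity) hw hx0 hint hlim
  have hlo := tendsto_mul_measureReal_Iio_of_bilateral hα (by positivity) hw hx0 hint hlim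
  have hmain : Tendsto (fun q : ℝ × ℝ => w q * G q.1 q.2) (windowFilter σ)
      (𝓝 (1 / Gamma γ / Gamma (α + 1))) := by
    refine tendsto_of_tendsto_of_tendsto_of_le_of_le' hlo hup ?_ ?_
    · filter_upwards [hw, ht0] with q h1 h2
      exact mul_le_mul_of_nonneg_left (lsMeasure_real_Iio_le (hmono _ h2) (hbot _ h2) _) h1
    · filter_upwards [hw, ht0] with q h1 h2
      exact mul_le_mul_of_nonneg_left (le_lsMeasure_real_Iic (hmono _ h2) (hbot _ h2) _) h1
  have hfin := (hmain.const_mul (Gamma γ * Gamma (α + 1))).sub_const 1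
  have hone : Gamma γ * Gamma (α + 1) * (1 / Gamma γ / Gamma (α + 1)) - 1 = 0 := by
    field_simp
    ring
  rw [hone] at hfin
  refine hfin.congr fun q => ?_
  simp only [hw_def, one_div_mul_eq_div]
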